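/- Let $X$ be a complex Banach space, $\mathbb B$ its open unit ball, and for $x\in X$ let $J(x)=\{x^*\in X^*:\ \|x^*\|=\|x\|,\ \langle x,x^*\rangle=\|x\|^2\}$. Let $\mathcal M$ be the class of all holomorphic mappings $h:\mathbb B\to X$ with $h(0)=0$, $Dh(0)=\mathrm{Id}$ and $\operatorname{Re}\langle h(x),x^*\rangle\ge 0$ for all $x\in\mathbb B\setminus\{0\}$ and $x^*\in J(x)$. For such $h$ write $H_k(x)=\frac1{k!}D^kh(0)[x^k]$, and for $e\in\partial\mathbb B$, $e^*\in J(e)$ and $\lambda,\mu\in\mathbb C$ let $$\Psi_e(h,\lambda,\mu)=H_3(e)-\frac{\mu}{2}D^2h(0)[e,H_2(e)]-(\lambda-\mu)\langle H_2(e),e^*\rangle H_2(e).$$ Theorem. Let $h\in\mathcal M$ and let $\{u_t\}_{t\ge0}$ be the semigroup generated by $h$, that is, $u_t(x)\in\mathbb B$, $\frac{\partial}{\partial t}u_t(x)+h(u_t(x))=0$ and $u_0(x)=x$ for all $x\in\mathbb B$ and $t\ge 0$. Then for every $t\ge0$ the mapping $u_t$ is analytic at the origin, and for every $e\in\partial\mathbb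 B$ (and every $e^*\in J(e)$) $$\frac1{2!}D^2u_t(0)[e^2]=e^{-t}\,(e^{-t}-1)\,H_2(e),$$ $$\frac1{3!}D^3u_t(0)[e^3]=\frac{e^{-t}\,(e^{-2t}-1)}{2}\,\Psi_e(h,\lambda,\lambda),\qquad \lambda=\frac{2(1-e^{-t})}{1+e^{-t}}.$$ -/

import Mathlib

open Set Metric

namespace FeketeSzego

variable {X : Type*} [NormedAddCommGroup X] [NormedSpace ℂ X]

/-- The set `J(x)` of support functionals at the point `x`. -/
def supportFunctionals (x : X) : Set (StrongDual ℂ X) :=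
  {a | ‖a‖ = ‖x‖ ∧ a x = ((‖x‖ ^ 2 : ℝ) : ℂ)}

/-- The `k`-th homogeneous polynomial `P_k(x) = (1/k!) D^k f(0)[x^k]` in the Taylor expansion of
`f` at the origin. -/
noncomputable def homPoly (k : ℕ) (f : X → X) (x : X) : X :=
  (1 / (k.factorial : ℂ)) • iteratedFDeriv ℂ k f 0 (fun _ => x)

/-- The Fekete–Szegő mapping
`Ψ_e(f, l, m) = P₃(e) - (m/2) D²f(0)[e, P₂(e)] - (l - m) ⟨P₂(e), e*⟩ P₂(e)`,
for a given `e` and a given support functional `e*` at `e`. -/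
noncomputable def Psi (e : X) (eStar : StrongDual ℂ X) (f : X → X) (l m : ℂ) : X :=
  homPoly 3 f e - (m / 2) • iteratedFDeriv ℂ 2 f 0 ![e, homPoly 2 f e]
    - ((l - m) * eStar (homPoly 2 f e)) • homPoly 2 f e

/-- The class `M`: normalized holomorphic mappings `h` of the open unit ball into `X` with
`Re ⟨h(x), x*⟩ ≥ 0` for all `x ≠ 0` in the ball and all `x* ∈ J(x)`.
Only the values of `h` on the ball matter. -/
structure ClassM (h : X → X) : Prop where
  holomorphic : DifferentiableOn ℂ h (ball 0 1)
  map_zero : h 0 = 0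
  fderiv_zero : fderiv ℂ h 0 = ContinuousLinearMap.id ℂ X
  re_nonneg : ∀ x ∈ ball (0 : X) 1, x ≠ 0 → ∀ a ∈ supportFunctionals x, 0 ≤ (a (h x)).re

/-- `u` is the semigroup generated by `h` on the open unit ball: for every `x` in the ball,
`t ↦ u t x`, `t ≥ 0`, is the solution in the ball of the initial value problem
`∂u/∂t + h(u) = 0`, `u 0 x = x` (at `t = 0` the derivative is the right derivative). -/
structure IsSemigroupGeneratedBy (u : ℝ → X → X) (h : X → X) : Prop where
  mem_ball : ∀ t, 0 ≤ t → ∀ x ∈ ball (0 : X) 1, u t x ∈ ball (0 : X) 1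
  initial : ∀ x ∈ ball (0 : X) 1, u 0 x = x
  ode : ∀ x ∈ ball (0 : X) 1, ∀ t, 0 ≤ t →
    HasDerivWithinAt (fun s => u s x) (-h (u t x)) (Ici 0) t

end FeketeSzego

/-! Write `a = exp (-s)`. Inserting a Taylor expansion of the flow into `∂u/∂s + h(u) = 0` gives a
triangular system of scalar equations. The linear coefficient is `a`. The coefficient of `H_2`
solves `c' + c = -a^2`, that of `H_3` solves `c' + c = -a^3`, and that of `D²h(0)[x, H_2(x)]` solves
`c' + c = a^2 - a^3`. The last two solutions, `a(a^2-1)/2` and `a(1-a)^2/2`, have ratio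
`-(1-a)/(1+a) = -λ/2`. This is why `Ψ_e(h, λ, λ)` appears: its `e*` term has factor `λ - λ = 0`.

Differentiation of the flow in the initial point is avoided. The explicit cubic `cubicFlow`
satisfies the equation up to `O(‖x‖^4)`, uniformly on `[0, t]` (`isBigO_cubicFlowDeriv_add`), so
Gronwall's inequality puts it within `O(‖x‖^4)` of the flow. Coefficients are then compared on
complex lines (`eq_zero_of_isBigO_pow`).

Analyticity of `u t` comes from Euler's method: its iterates are holomorphic on one fixed ball and
converge there uniformly to the flow, so a Weierstrass theorem applies. That holomorphic maps of
Banach spaces are analytic is derived from Schwarz-type estimates and one-variable Taylor series. -/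

namespace FeketeSzego

/-! ### Cauchy estimates and holomorphy of the derivative. -/

section Holomorphic

open Filter Topology
open scoped Nat ContDiff

variable {E F : Type*} [NormedAddCommGroup E] [NormedSpace ℂ E]
  [NormedAddCommGroup F] [NormedSpace ℂ F]

/-- Cauchy's estimate for the derivative of a bounded holomorphic map on a ball. -/
theorem norm_fderiv_le_of_forall_mem_ball {f : E → F} {c : E} {R M : ℝ} (hR : 0 < R)
    (hf : DifferentiableOn ℂ f (ball c R)) (hM : ∀ x ∈ ball c R, ‖f x‖ ≤ M) :
    ‖fderiv ℂ f c‖ ≤ 2 * M / R := by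
  refine Complex.norm_fderiv_le_div_of_mapsTo_ball hf (fun x hx => ?_) hR
  rw [mem_closedBall, dist_eq_norm]
  have h1 := hM x hx
  have h2 := hM c (mem_ball_self hR)
  linarith [norm_sub_le (f x) (f c)]

/-- The first-order Taylor remainder of a bounded holomorphic map is quadratically small. -/
theorem norm_sub_sub_fderiv_le {f : E → F} {c v : E} {R M : ℝ}
    (hf : DifferentiableOn ℂ f (ball c R)) (hM : ∀ x ∈ ball c R, ‖f x‖ ≤ M) (hv : ‖v‖ < R) :
    ‖f (c + v) - f c - fderiv ℂ f c v‖ ≤ 4 * M * (‖v‖ / R) ^ 2 := by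
  have hR : 0 < R := (norm_nonneg v).trans_lt hv
  have hD := norm_fderiv_le_of_forall_mem_ball hR hf hM
  have hfc : DifferentiableAt ℂ f c := hf.differentiableAt (ball_mem_nhds c hR)
  -- Without its linear part the map deviates from its central value to second order, so a
  -- higher-order Schwarz lemma applies. The constant is `4M = M + M + 2M`, the last term bounding
  -- the linear part.
  have key := Complex.dist_le_mul_div_pow_of_mapsTo_ball_of_isLittleO (n := 1) (R₂ := 4 * M)
    (f := fun x => f x - fderiv ℂ f c (x - c)) (c := c) (z := c + v) (R₁ := R)
    (hf.sub (by fun_prop)) ?_ ?_ (by simpa using hv)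
  · simpa [dist_eq_norm, sub_right_comm] using key
  · intro x hx
    rw [mem_closedBall, dist_eq_norm]
    have h1 := hM x hx
    have h2 := hM c (mem_ball_self hR)
    have h3 : ‖fderiv ℂ f c (x - c)‖ ≤ 2 * M := by
      refine ((fderiv ℂ f c).le_of_opNorm_le hD _).trans ?_
      rw [mem_ball, dist_eq_norm] at hx
      have : 0 ≤ 2 * M / R := (norm_nonneg _).trans hD
      calc 2 * M / R * ‖x - c‖ ≤ 2 * M / R * R := by gcongr
        _ = 2 * M := by field_simp
    simp only [sub_self, map_zero, sub_zero]
    linarith [norm_sub_le (f x - fderiv ℂ f c (x - c)) (f c), norm_sub_le (f x) (fderiv ℂ f c (x - c))]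
  · have := hfc.hasFDerivAt.isLittleO
    simp only [pow_one]
    refine (this.norm_right).congr_left fun x => ?_
    simp only [sub_self, map_zero, sub_zero]
    abel

/-- A holomorphic map is bounded and holomorphic on a ball around each point of its domain. -/
theorem exists_ball_forall_norm_le {f : E → F} {U : Set E} (hU : IsOpen U)
    (hf : DifferentiableOn ℂ f U) {c : E} (hc : c ∈ U) :
    ∃ R > 0, ∃ M, ball c R ⊆ U ∧ ∀ x ∈ ball c R, ‖f x‖ ≤ M := by
  have hcont : ContinuousAt f c := (hf.differentiableAt (hU.mem_nhds hc)).continuousAt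
  have h1 : ∀ᶠ x in 𝓝 c, ‖f x‖ < ‖f c‖ + 1 :=
    hcont.norm.eventually_lt continuousAt_const (by simp)
  obtain ⟨R, hR, h⟩ := Metric.eventually_nhds_iff_ball.1 (h1.and (hU.mem_nhds hc))
  exact ⟨R, hR, ‖f c‖ + 1, fun x hx => (h x hx).2, fun x hx => (h x hx).1.le⟩

/-- **Weierstrass convergence theorem** in complex Banach spaces. -/
theorem differentiableOn_ball_of_tendstoUniformlyOn [CompleteSpace F] {f : ℕ → E → F} {g : E → F}
    {c : E} {R : ℝ} (hf : ∀ n, DifferentiableOn ℂ (f n) (ball c R))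
    (hfg : TendstoUniformlyOn f g atTop (ball c R)) : DifferentiableOn ℂ g (ball c R) := by
  intro x hx
  set ρ := (R - dist x c) / 2 with hρdef
  have hρ : 0 < ρ := by rw [mem_ball] at hx; simp only [hρdef]; linarith
  have hsub : ∀ y ∈ ball x ρ, ball y ρ ⊆ ball c R := fun y hy => by
    refine ball_subset_ball' ?_
    rw [mem_ball] at hy
    have := dist_triangle y x c
    simp only [hρdef] at hy ⊢
    linarith
  have hsub' : ball x ρ ⊆ ball c R := hsub x (mem_ball_self hρ)
  have hd : ∀ n, ∀ y ∈ ball c R, DifferentiableAt ℂ (f n) y := fun n y hy =>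
    (hf n).differentiableAt (isOpen_ball.mem_nhds hy)
  have hC : UniformCauchySeqOn (fun n => fderiv ℂ (f n)) atTop (ball x ρ) := by
    rw [Metric.uniformCauchySeqOn_iff]
    intro ε hε
    obtain ⟨N, hN⟩ := Metric.uniformCauchySeqOn_iff.1 hfg.uniformCauchySeqOn (ε * ρ / 4) (by positivity)
    refine ⟨N, fun m hm n hn y hy => ?_⟩
    have hyR := hsub' hy
    have := norm_fderiv_le_of_forall_mem_ball (f := fun z => f m z - f n z) (c := y) (M := ε * ρ / 4) hρ
      (((hf m).sub (hf n)).mono (hsub y hy))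
      (fun z hz => by rw [← dist_eq_norm]; exact (hN m hm n hn z (hsub y hy hz)).le)
    rw [fderiv_fun_sub (hd m y hyR) (hd n y hyR), ← dist_eq_norm] at this
    refine this.trans_lt ?_
    rw [div_lt_iff₀ hρ]
    nlinarith [mul_pos hε hρ]
  have hlim : ∀ y ∈ ball x ρ, ∃ L, Tendsto (fun n => fderiv ℂ (f n) y) atTop (𝓝 L) := fun y hy =>
    cauchySeq_tendsto_of_complete (hC.cauchySeq hy)
  choose! g' hg' using hlim
  have := hasFDerivAt_of_tendstoUniformlyOn isOpen_ball
    (hC.tendstoUniformlyOn_of_tendsto hg')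
    (fun n y hy => (hd n y (hsub' hy)).hasFDerivAt)
    (fun y hy => hfg.tendsto_at (hsub' hy)) (mem_ball_self hρ)
  exact this.differentiableAt.differentiableWithinAt

/-- The directional derivatives of a holomorphic map are holomorphic. -/
theorem differentiableOn_fderiv_apply [CompleteSpace F] {f : E → F} {U : Set E} (hU : IsOpen U)
    (hf : DifferentiableOn ℂ f U) (y : E) : DifferentiableOn ℂ (fun x => fderiv ℂ f x y) U := by
  intro c hc
  obtain ⟨R, hR, M, hRU, hM⟩ := exists_ball_forall_norm_le hU hf hc
  have hsub : ∀ x ∈ ball c (R / 2), ball x (R / 2) ⊆ ball c R := fun x hx => by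
    refine ball_subset_ball' ?_
    rw [mem_ball] at hx
    linarith
  have hM0 : 0 ≤ M := (norm_nonneg _).trans (hM c (mem_ball_self hR))
  set s : ℕ → ℝ := fun n => R / 2 / (‖y‖ + 1) * (1 / ((n : ℝ) + 1)) with hs
  have hs0 : ∀ n, 0 < s n := fun n => by simp only [hs]; positivity
  have hsn : ∀ n, s n * ‖y‖ < R / 2 := fun n => by
    have h1 : (1 : ℝ) / ((n : ℝ) + 1) ≤ 1 := by
      rw [div_le_one (by positivity)]; linarith [(Nat.cast_nonneg n : (0 : ℝ) ≤ n)]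
    have h2 : s n ≤ R / 2 / (‖y‖ + 1) := mul_le_of_le_one_right (by positivity) h1
    calc s n * ‖y‖ ≤ R / 2 / (‖y‖ + 1) * ‖y‖ := by gcongr
      _ < R / 2 / (‖y‖ + 1) * (‖y‖ + 1) := by gcongr; linarith
      _ = R / 2 := by field_simp
  have hslim : Tendsto s atTop (𝓝 0) := by
    simpa [hs] using tendsto_one_div_add_atTop_nhds_zero_nat.const_mul (R / 2 / (‖y‖ + 1))
  have hball : ∀ n, ∀ x ∈ ball c (R / 2), x + (s n : ℂ) • y ∈ ball c R := fun n x hx => by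
    refine hsub x hx ?_
    simpa [norm_smul, abs_of_pos (hs0 n)] using hsn n
  -- Difference quotients with steps `s n` are holomorphic, and the quadratic remainder makes them
  -- converge uniformly on the half-radius ball.
  refine (differentiableOn_ball_of_tendstoUniformlyOn (c := c) (R := R / 2)
    (f := fun n x => (s n : ℂ)⁻¹ • (f (x + (s n : ℂ) • y) - f x)) (fun n => ?_) ?_
      ).differentiableAt (ball_mem_nhds c (half_pos hR)) |>.differentiableWithinAt
  · refine DifferentiableOn.const_smul (DifferentiableOn.sub ?_ ?_) _
    · exact (hf.mono hRU).comp (by fun_prop) (hball n)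
    · exact hf.mono ((ball_subset_ball (by linarith)).trans hRU)
  · rw [Metric.tendstoUniformlyOn_iff]
    intro ε hε
    have : Tendsto (fun n => 4 * M * s n * (‖y‖ / (R / 2)) ^ 2) atTop (𝓝 0) := by
      simpa using (hslim.const_mul (4 * M)).mul_const ((‖y‖ / (R / 2)) ^ 2)
    filter_upwards [this.eventually_lt_const hε] with n hn x hx
    refine lt_of_le_of_lt ?_ hn
    have h1 := norm_sub_sub_fderiv_le (c := x) (v := (s n : ℂ) • y) (R := R / 2) (M := M)
      ((hf.mono hRU).mono (hsub x hx)) (fun z hz => hM z (hsub x hx hz))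
      (by simpa [norm_smul, abs_of_pos (hs0 n)] using hsn n)
    have hne : (s n : ℂ) ≠ 0 := by exact_mod_cast (hs0 n).ne'
    have h2 : (s n : ℂ)⁻¹ • (f (x + (s n : ℂ) • y) - f x) - fderiv ℂ f x y =
        (s n : ℂ)⁻¹ • (f (x + (s n : ℂ) • y) - f x - fderiv ℂ f x ((s n : ℂ) • y)) := by
      rw [map_smul, smul_sub _ (f (x + (s n : ℂ) • y) - f x), inv_smul_smul₀ hne]
    rw [dist_comm, dist_eq_norm, h2, norm_smul, norm_inv, Complex.norm_real, Real.norm_of_nonneg (hs0 n).le]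
    rw [norm_smul, Complex.norm_real, Real.norm_of_nonneg (hs0 n).le] at h1
    calc (s n)⁻¹ * _ ≤ (s n)⁻¹ * (4 * M * (s n * ‖y‖ / (R / 2)) ^ 2) := by
          gcongr
      _ = 4 * M * s n * (‖y‖ / (R / 2)) ^ 2 := by
          have := (hs0 n).ne'
          field_simp

/-- The Fréchet derivative of a holomorphic map is holomorphic. -/
theorem differentiableOn_fderiv [CompleteSpace F] {f : E → F} {U : Set E} (hU : IsOpen U)
    (hf : DifferentiableOn ℂ f U) : DifferentiableOn ℂ (fderiv ℂ f) U := by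
  intro c hc
  obtain ⟨R, hR, M, hRU, hM⟩ := exists_ball_forall_norm_le hU hf hc
  have hM0 : 0 ≤ M := (norm_nonneg _).trans (hM c (mem_ball_self hR))
  have hsub : ∀ x ∈ ball c (R / 2), ball x (R / 2) ⊆ ball c R := fun x hx => by
    refine ball_subset_ball' ?_
    rw [mem_ball] at hx
    linarith
  set K := 2 * M / (R / 2) with hK
  have hK0 : 0 ≤ K := by positivity
  have hbound : ∀ y, ∀ x ∈ ball c (R / 2), ‖fderiv ℂ f x y‖ ≤ K * ‖y‖ := fun y x hx =>
    (fderiv ℂ f x).le_of_opNorm_le (norm_fderiv_le_of_forall_mem_ball (half_pos hR)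
      ((hf.mono hRU).mono (hsub x hx)) fun z hz => hM z (hsub x hx hz)) y
  have hdiff := fun y => differentiableOn_fderiv_apply hU hf y
  have hdiffAt : ∀ y, DifferentiableAt ℂ (fun x => fderiv ℂ f x y) c := fun y =>
    (hdiff y).differentiableAt (hU.mem_nhds hc)
  have hdiffB : ∀ y, DifferentiableOn ℂ (fun x => fderiv ℂ f x y) (ball c (R / 2)) := fun y =>
    (hdiff y).mono ((ball_subset_ball (by linarith)).trans hRU)
  -- The candidate second derivative; Cauchy's estimate applied twice makes it bounded.
  let B : E →L[ℂ] E →L[ℂ] F := LinearMap.mkContinuous₂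
    (LinearMap.mk₂ ℂ (fun v y => fderiv ℂ (fun x => fderiv ℂ f x y) c v)
      (fun v w y => map_add _ _ _) (fun a v y => map_smul _ _ _)
      (fun v y z => by
        simp only [map_add]
        rw [fderiv_fun_add (hdiffAt y) (hdiffAt z)]; rfl)
      (fun a v y => by
        simp only [map_smul]
        rw [fderiv_fun_const_smul (hdiffAt y)]; rfl)) (2 * K / (R / 2)) (fun v y => by
      simp only [LinearMap.mk₂_apply]
      refine ((fderiv ℂ (fun x => fderiv ℂ f x y) c).le_of_opNorm_le
        (norm_fderiv_le_of_forall_mem_ball (half_pos hR) (hdiffB y) (hbound y)) v).trans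
          (le_of_eq ?_)
      ring)
  have hB : ∀ v y, B v y = fderiv ℂ (fun x => fderiv ℂ f x y) c v := fun v y => rfl
  have : HasFDerivAt (fderiv ℂ f) B c := by
    rw [hasFDerivAt_iff_isLittleO_nhds_zero]
    refine Asymptotics.IsBigO.trans_isLittleO (g := fun v : E => ‖v‖ ^ 2) ?_ ?_
    · refine Asymptotics.IsBigO.of_bound (4 * K / (R / 2) ^ 2) ?_
      filter_upwards [ball_mem_nhds (0 : E) (half_pos hR)] with v hv
      refine ContinuousLinearMap.opNorm_le_bound _ (by positivity) fun y => ?_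
      -- The remainder bound is linear in `‖y‖`, so it upgrades from each direction `y` to the
      -- operator norm.
      have := norm_sub_sub_fderiv_le (hdiffB y) (hbound y) (mem_ball_zero_iff.1 hv)
      simp only [sub_apply, hB, norm_pow, norm_norm]
      refine this.trans (le_of_eq ?_)
      ring
    · simpa using (Asymptotics.isLittleO_norm_pow_id (E' := E) (one_lt_two))
  exact this.differentiableAt.differentiableWithinAt

end Holomorphic

/-! ### From holomorphic to analytic. -/

section Analyticity

open Filter Topology
open scoped Nat ContDiff

universe u

variable {E : Type u} [NormedAddCommGroup E] [NormedSpace ℂ E]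

/-- Holomorphic maps are infinitely differentiable. -/
theorem contDiffOn_of_differentiableOn {U : Set E} (hU : IsOpen U) (n : ℕ) :
    ∀ {F : Type u} [NormedAddCommGroup F] [NormedSpace ℂ F] [CompleteSpace F] {f : E → F},
      DifferentiableOn ℂ f U → ContDiffOn ℂ n f U := by
  induction n with
  | zero => exact fun hf => contDiffOn_zero.2 hf.continuousOn
  | succ n ih =>
    -- The induction passes from target `F` to `E →L[ℂ] F`, so `F` is general and shares a universe
    -- with `E`.
    intro F _ _ _ f hf
    rw [Nat.cast_succ, contDiffOn_succ_iff_fderiv_of_isOpen hU]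
    exact ⟨hf, fun h => absurd h (by simp), ih (differentiableOn_fderiv hU hf)⟩

variable {F : Type u} [NormedAddCommGroup F] [NormedSpace ℂ F] [CompleteSpace F]

theorem differentiableOn_iteratedFDeriv {f : E → F} {U : Set E} (hU : IsOpen U)
    (hf : DifferentiableOn ℂ f U) (n : ℕ) : DifferentiableOn ℂ (iteratedFDeriv ℂ n f) U :=
  fun x hx => (((contDiffOn_of_differentiableOn hU (n + 1) hf).contDiffAt
    (hU.mem_nhds hx)).differentiableAt_iteratedFDeriv
      (by exact_mod_cast n.lt_succ_self)).differentiableWithinAt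

/-- Cauchy's estimates for the higher derivatives of a bounded holomorphic map. -/
theorem norm_iteratedFDeriv_le_of_forall_mem_ball {f : E → F} {c : E} {R M δ : ℝ} (hδ : 0 < δ)
    (hf : DifferentiableOn ℂ f (ball c R)) (hM : ∀ x ∈ ball c R, ‖f x‖ ≤ M) (n : ℕ) :
    ∀ x ∈ ball c (R - n * δ), ‖iteratedFDeriv ℂ n f x‖ ≤ M * (2 / δ) ^ n := by
  induction n with
  | zero => simpa using hM
  | succ n ih =>
    intro x hx
    have hsub : ball x δ ⊆ ball c (R - n * δ) := by
      refine ball_subset_ball' ?_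
      rw [mem_ball] at hx
      push_cast at hx
      linarith
    have hsub' : ball x δ ⊆ ball c R :=
      hsub.trans (ball_subset_ball (by linarith [mul_nonneg n.cast_nonneg hδ.le]))
    rw [← norm_fderiv_iteratedFDeriv]
    refine (norm_fderiv_le_of_forall_mem_ball hδ
      ((differentiableOn_iteratedFDeriv isOpen_ball hf n).mono hsub')
        (fun y hy => ih y (hsub hy))).trans (le_of_eq ?_)
    rw [pow_succ]
    ring

/-- Along a complex line, the iterated derivatives of a holomorphic map are the diagonal values of
its iterated Fréchet derivatives. -/
theorem iteratedDeriv_add_smul {f : E → F} {U : Set E} (hU : IsOpen U)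
    (hf : DifferentiableOn ℂ f U) (x y : E) (n : ℕ) :
    ∀ z : ℂ, x + z • y ∈ U →
      iteratedDeriv n (fun s : ℂ => f (x + s • y)) z = iteratedFDeriv ℂ n f (x + z • y) fun _ => y := by
  induction n with
  | zero => simp
  | succ n ih =>
    intro z hz
    have hV : IsOpen {s : ℂ | x + s • y ∈ U} := hU.preimage (by fun_prop)
    rw [iteratedDeriv_succ, ← ContDiffAt.deriv_fderiv_add_smul]
    · exact ((hV.mem_nhds hz : _ ∈ 𝓝 z) |> fun h => Filter.EventuallyEq.deriv_eq
        (Filter.eventually_of_mem h fun s hs => ih s hs))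
    · exact_mod_cast (contDiffOn_of_differentiableOn hU (n + 1) hf).contDiffAt (hU.mem_nhds hz)

/-- A holomorphic map between complex Banach spaces is analytic. -/
theorem analyticAt_of_differentiableOn {f : E → F} {U : Set E} (hU : IsOpen U)
    (hf : DifferentiableOn ℂ f U) {c : E} (hc : c ∈ U) : AnalyticAt ℂ f c := by
  obtain ⟨R, hR, M, hRU, hM⟩ := exists_ball_forall_norm_le hU hf hc
  have hM0 : 0 ≤ M := (norm_nonneg _).trans (hM c (mem_ball_self hR))
  replace hf := hf.mono hRU
  let p : FormalMultilinearSeries ℂ E F := fun n => (n ! : ℂ)⁻¹ • iteratedFDeriv ℂ n f c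
  have hp : ∀ n, ‖p n‖ ≤ (M * Real.exp 1) * (2 * Real.exp 1 / R) ^ n := fun n => by
    have hn : (0 : ℝ) < n + 1 := by positivity
    -- With `δ = R/(n+1)`, the `n` successive shrinkings still leave `c` inside; the resulting
    -- `(n+1)^n / n!` grows only geometrically.
    have h1 := norm_iteratedFDeriv_le_of_forall_mem_ball (δ := R / (n + 1)) (by positivity) hf hM n c
      (mem_ball_self (by rw [sub_pos, ← mul_div_assoc, div_lt_iff₀ hn]; nlinarith))
    have h2 := Real.pow_div_factorial_le_exp _ hn.le n
    simp only [p, norm_smul, norm_inv, Complex.norm_natCast]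
    calc (n ! : ℝ)⁻¹ * ‖iteratedFDeriv ℂ n f c‖ ≤ (n ! : ℝ)⁻¹ * (M * (2 / (R / (n + 1))) ^ n) := by
          gcongr
      _ = M * ((n + 1 : ℝ) ^ n / n !) * (2 / R) ^ n := by
          rw [show 2 / (R / ((n : ℝ) + 1)) = (n + 1) * (2 / R) by field_simp, mul_pow]
          ring
      _ ≤ M * Real.exp (n + 1) * (2 / R) ^ n := by gcongr
      _ = _ := by
          rw [Real.exp_add, ← Real.exp_one_pow n, show 2 * Real.exp 1 / R = Real.exp 1 * (2 / R) by ring,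
            mul_pow]
          ring
  set ρ : NNReal := ⟨R / (2 * Real.exp 1), by positivity⟩ with hρ
  have hρ0 : 0 < ρ := by
    rw [← NNReal.coe_pos]
    change 0 < R / (2 * Real.exp 1)
    positivity
  have hρR : (ρ : ℝ) ≤ R := by
    change R / (2 * Real.exp 1) ≤ R
    refine div_le_self hR.le ?_
    linarith [Real.add_one_le_exp 1]
  have hrad : (ρ : ENNReal) ≤ p.radius := by
    refine p.le_radius_of_bound (M * Real.exp 1) fun n => ?_
    calc ‖p n‖ * (ρ : ℝ) ^ n ≤ (M * Real.exp 1) * (2 * Real.exp 1 / R) ^ n * (ρ : ℝ) ^ n := by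
          gcongr; exact hp n
      _ = M * Real.exp 1 := by
          rw [mul_assoc, ← mul_pow]
          change M * Real.exp 1 * (2 * Real.exp 1 / R * (R / (2 * Real.exp 1))) ^ n = _
          rw [show 2 * Real.exp 1 / R * (R / (2 * Real.exp 1)) = 1 by field_simp, one_pow, mul_one]
  refine ⟨p, ρ, ⟨hrad, by exact_mod_cast hρ0, fun {y} hy => ?_⟩⟩
  have hyρ : ‖y‖ < R := by
    refine lt_of_lt_of_le ?_ hρR
    simpa using hy
  -- A disc of radius above `1` on the line through `c` and `c + y`, so that the one-variable Taylor
  -- series can be evaluated at `1`. Dividing by the midpoint of `‖y‖` and `R` also covers `y = 0`.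
  obtain ⟨r, hr1, hr⟩ : ∃ r : ℝ, 1 < r ∧ ∀ s ∈ ball (0 : ℂ) r, c + s • y ∈ ball c R := by
    refine ⟨R / (‖y‖ + (R - ‖y‖) / 2), ?_, fun s hs => ?_⟩
    · rw [one_lt_div (by linarith [norm_nonneg y])]
      linarith
    · have hpos : 0 < ‖y‖ + (R - ‖y‖) / 2 := by linarith [norm_nonneg y]
      rw [mem_ball_zero_iff, lt_div_iff₀ hpos] at hs
      rw [mem_ball, dist_eq_norm, add_sub_cancel_left, norm_smul]
      refine lt_of_le_of_lt ?_ hs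
      gcongr
      linarith
  have := Complex.hasSum_taylorSeries_on_ball (f := fun s : ℂ => f (c + s • y)) (c := 0) (r := r)
    (z := 1) (hf.comp (by fun_prop) hr) (by simpa using hr1)
  simp only [sub_zero, one_pow, one_smul] at this
  convert this using 2 with n
  have h0 : c + (0 : ℂ) • y ∈ ball c R := by simpa using hR
  rw [iteratedDeriv_add_smul isOpen_ball hf c y n 0 h0, zero_smul, add_zero]
  rfl

end Analyticity

/-! ### Euler's method and analyticity of the flow. -/

section Flow

open Filter Topology
open scoped NNReal

variable {X : Type*} [NormedAddCommGroup X] [NormedSpace ℂ X]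

/-- A trajectory of a vector field that is Lipschitz near its zero `0` grows at most
exponentially. -/
theorem norm_trajectory_le {h : X → X} {K : ℝ≥0} {r ε t : ℝ} (hL : LipschitzOnWith K h (ball 0 r))
    (h0 : h 0 = 0) {v : ℝ → X}
    (hv : ∀ s, 0 ≤ s → HasDerivWithinAt v (-h (v s)) (Ici 0) s)
    (hε : 0 < ε) (hvε : ‖v 0‖ ≤ ε) (hr : ε * Real.exp ((K + 1) * t) < r) :
    ∀ s ∈ Icc 0 t, ‖v s‖ ≤ ε * Real.exp ((K + 1) * s) := by
  have hB : ∀ s : ℝ, HasDerivAt (fun s => ε * Real.exp ((K + 1) * s))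
      (ε * (Real.exp ((K + 1) * s) * (K + 1))) s := fun s => by
    simpa using (((hasDerivAt_id s).const_mul ((K : ℝ) + 1)).exp.const_mul ε)
  -- The rate `K + 1` makes the comparison strict. The derivative is tested only where `‖v s‖` meets
  -- the barrier, which places `v s` in the ball without prior confinement.
  refine image_norm_le_of_norm_deriv_right_lt_deriv_boundary
    (fun s hs => ((hv s hs.1).continuousWithinAt).mono fun y hy => hy.1)
    (fun s hs => (hv s hs.1).mono fun y hy => hs.1.trans hy) (by simpa using hvε) hB
    fun s hs hsB => ?_
  have hsr : ‖v s‖ < r := by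
    rw [hsB]
    refine lt_of_le_of_lt ?_ hr
    gcongr
    exact hs.2.le
  have h1 : ‖h (v s)‖ ≤ K * ‖v s‖ := by
    simpa [h0] using hL.dist_le_mul (v s) (by simpa using hsr) 0
      (by simpa using (norm_nonneg _).trans_lt hsr)
  have h2 : 0 < ‖v s‖ := by rw [hsB]; positivity
  rw [norm_neg]
  calc ‖h (v s)‖ ≤ K * ‖v s‖ := h1
    _ < (K + 1) * ‖v s‖ := by linarith
    _ = _ := by rw [hsB]; ring

/-- One step of Euler's method for the equation `v' + h v = 0`. -/
def eulerStep (h : X → X) (τ : ℝ) (x : X) : X := x - (τ : ℂ) • h x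

theorem norm_eulerStep_le {h : X → X} {K : ℝ≥0} {r τ : ℝ} (hL : LipschitzOnWith K h (ball 0 r))
    (h0 : h 0 = 0) (hτ : 0 ≤ τ) {x : X} (hx : ‖x‖ < r) :
    ‖eulerStep h τ x‖ ≤ Real.exp (K * τ) * ‖x‖ := by
  have h1 : ‖h x‖ ≤ K * ‖x‖ := by
    simpa [h0] using hL.dist_le_mul x (by simpa using hx) 0
      (by simpa using (norm_nonneg _).trans_lt hx)
  calc ‖eulerStep h τ x‖ ≤ ‖x‖ + ‖(τ : ℂ) • h x‖ := norm_sub_le _ _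
    _ = ‖x‖ + τ * ‖h x‖ := by rw [norm_smul, Complex.norm_real, Real.norm_of_nonneg hτ]
    _ ≤ ‖x‖ + τ * (K * ‖x‖) := by gcongr
    _ = (K * τ + 1) * ‖x‖ := by ring
    _ ≤ _ := by gcongr; exact Real.add_one_le_exp _

/-- The smallness condition at the final time keeps every intermediate iterate in the ball where `h`
is Lipschitz. -/
theorem norm_eulerStep_iterate_le {h : X → X} {K : ℝ≥0} {r τ : ℝ}
    (hL : LipschitzOnWith K h (ball 0 r)) (h0 : h 0 = 0) (hτ : 0 ≤ τ) {x : X} {n : ℕ}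
    (hx : Real.exp (K * (n * τ)) * ‖x‖ < r) :
    ∀ k ≤ n, ‖(eulerStep h τ)^[k] x‖ ≤ Real.exp (K * (k * τ)) * ‖x‖ := by
  intro k
  induction k with
  | zero => simp
  | succ k ih =>
    intro hk
    have ih' := ih (by omega)
    rw [Function.iterate_succ_apply']
    have hlt : ‖(eulerStep h τ)^[k] x‖ < r := by
      refine (ih'.trans ?_).trans_lt hx
      have : (k : ℝ) ≤ n := by exact_mod_cast (by omega : k ≤ n)
      gcongr
    calc _ ≤ Real.exp (K * τ) * ‖(eulerStep h τ)^[k] x‖ := norm_eulerStep_le hL h0 hτ hlt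
      _ ≤ Real.exp (K * τ) * (Real.exp (K * (k * τ)) * ‖x‖) := by gcongr
      _ = _ := by
        rw [← mul_assoc, ← Real.exp_add]
        push_cast
        ring_nf

theorem norm_eulerStep_sub_le {h : X → X} {K : ℝ≥0} {r τ : ℝ}
    (hL : LipschitzOnWith K h (ball 0 r)) (hτ : 0 ≤ τ) {x y : X} (hx : ‖x‖ < r) (hy : ‖y‖ < r) :
    ‖eulerStep h τ x - eulerStep h τ y‖ ≤ Real.exp (K * τ) * ‖x - y‖ := by
  have h1 : ‖h x - h y‖ ≤ K * ‖x - y‖ := by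
    simpa [dist_eq_norm] using hL.dist_le_mul x (by simpa using hx) y (by simpa using hy)
  calc ‖eulerStep h τ x - eulerStep h τ y‖ = ‖(x - y) - (τ : ℂ) • (h x - h y)‖ := by
        simp only [eulerStep, smul_sub]; congr 1; abel
    _ ≤ ‖x - y‖ + ‖(τ : ℂ) • (h x - h y)‖ := norm_sub_le _ _
    _ = ‖x - y‖ + τ * ‖h x - h y‖ := by rw [norm_smul, Complex.norm_real, Real.norm_of_nonneg hτ]
    _ ≤ ‖x - y‖ + τ * (K * ‖x - y‖) := by gcongr
    _ = (K * τ + 1) * ‖x - y‖ := by ring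
    _ ≤ _ := by gcongr; exact Real.add_one_le_exp _

/-- The local error of Euler's method is quadratic in the step. -/
theorem norm_trajectory_sub_eulerStep_le {h : X → X} {K : ℝ≥0} {r t τ s : ℝ}
    (hL : LipschitzOnWith K h (ball 0 r)) (h0 : h 0 = 0) {v : ℝ → X}
    (hv : ∀ s, 0 ≤ s → HasDerivWithinAt v (-h (v s)) (Ici 0) s)
    (hvr : ∀ s ∈ Icc 0 t, ‖v s‖ < r) (hs : 0 ≤ s) (hτ : 0 ≤ τ) (hst : s + τ ≤ t) :
    ‖v (s + τ) - eulerStep h τ (v s)‖ ≤ K ^ 2 * r * τ ^ 2 := by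
  have hr : 0 < r := (norm_nonneg _).trans_lt (hvr s ⟨hs, by linarith⟩)
  have hmem : ∀ σ ∈ Icc s (s + τ), v σ ∈ ball (0 : X) r := fun σ hσ => by
    simpa using hvr σ ⟨hs.trans hσ.1, hσ.2.trans hst⟩
  have hnorm : ∀ x ∈ ball (0 : X) r, ‖h x‖ ≤ K * r := fun x hx => by
    have : ‖h x‖ ≤ K * ‖x‖ := by simpa [h0] using hL.dist_le_mul x hx 0 (by simpa using hr)
    refine this.trans ?_
    gcongr
    exact (mem_ball_zero_iff.1 hx).le
  have hcont : ContinuousOn v (Icc s (s + τ)) := fun σ hσ =>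
    (hv σ (hs.trans hσ.1)).continuousWithinAt.mono fun y hy => hs.trans hy.1
  have hder : ∀ σ ∈ Ico s (s + τ), HasDerivWithinAt v (-h (v σ)) (Ici σ) σ := fun σ hσ =>
    (hv σ (hs.trans hσ.1)).mono fun y hy => (hs.trans hσ.1).trans hy
  have hdist : ∀ σ ∈ Icc s (s + τ), ‖v σ - v s‖ ≤ K * r * τ := fun σ hσ => by
    refine (norm_image_sub_le_of_norm_deriv_right_le_segment hcont hder (fun σ hσ => by
      rw [norm_neg]; exact hnorm _ (hmem σ ⟨hσ.1, hσ.2.le⟩)) σ hσ).trans ?_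
    gcongr
    linarith [hσ.2]
  -- Adding `(σ - s) • h (v s)` leaves the derivative `h (v s) - h (v σ)`, which is at most `K`
  -- times the displacement `K r τ`.
  have key := norm_image_sub_le_of_norm_deriv_right_le_segment
    (f := fun σ => v σ + (σ - s) • h (v s)) (f' := fun σ => -h (v σ) + (1 : ℝ) • h (v s))
    (C := K * (K * r * τ)) (hcont.add (by fun_prop))
    (fun σ hσ => (hder σ hσ).add
      (((hasDerivAt_id σ).sub_const s).smul_const (h (v s))).hasDerivWithinAt)
    (fun σ hσ => by
      have h1 := hL.dist_le_mul _ (hmem s ⟨le_rfl, by linarith⟩) _ (hmem σ ⟨hσ.1, hσ.2.le⟩)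
      rw [dist_eq_norm, dist_comm, dist_eq_norm] at h1
      rw [one_smul, neg_add_eq_sub]
      refine h1.trans ?_
      gcongr
      exact hdist σ ⟨hσ.1, hσ.2.le⟩) (s + τ) ⟨by linarith, le_rfl⟩
  have e1 : v (s + τ) - eulerStep h τ (v s) =
      v (s + τ) + (s + τ - s) • h (v s) - (v s + (s - s) • h (v s)) := by
    simp only [eulerStep, add_sub_cancel_left, sub_self, zero_smul, add_zero, Complex.coe_smul]
    abel
  rw [e1]
  refine key.trans (le_of_eq ?_)
  ring

/-- The global error of Euler's method. -/
theorem norm_trajectory_sub_eulerStep_iterate_le {h : X → X} {K : ℝ≥0} {r τ : ℝ}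
    (hL : LipschitzOnWith K h (ball 0 r)) (h0 : h 0 = 0) {v : ℝ → X} {n : ℕ}
    (hv : ∀ s, 0 ≤ s → HasDerivWithinAt v (-h (v s)) (Ici 0) s)
    (hvr : ∀ s ∈ Icc 0 (n * τ), ‖v s‖ < r) (hτ : 0 ≤ τ)
    (hx : Real.exp (K * (n * τ)) * ‖v 0‖ < r) :
    ∀ k ≤ n, ‖v (k * τ) - (eulerStep h τ)^[k] (v 0)‖ ≤
      k * (K ^ 2 * r * τ ^ 2) * Real.exp (K * (k * τ)) := by
  have hr : 0 < r := (by positivity : (0 : ℝ) ≤ Real.exp (K * (n * τ)) * ‖v 0‖).trans_lt hx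
  intro k
  induction k with
  | zero => simp
  | succ k ih =>
    intro hk
    have ih' := ih (by omega)
    have hkn : (k : ℝ) + 1 ≤ n := by exact_mod_cast hk
    have hkτ : (k : ℝ) * τ ≤ n * τ := by gcongr; linarith
    rw [Function.iterate_succ_apply']
    have hE : ‖(eulerStep h τ)^[k] (v 0)‖ < r :=
      ((norm_eulerStep_iterate_le hL h0 hτ hx k (by omega)).trans (by gcongr)).trans_lt hx
    have h1 := norm_trajectory_sub_eulerStep_le (s := k * τ) hL h0 hv hvr (by positivity) hτ
      (by nlinarith)
    have h2 := norm_eulerStep_sub_le hL hτ (hvr (k * τ) ⟨by positivity, hkτ⟩) hE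
    have h3 : ((k + 1 : ℕ) : ℝ) * τ = k * τ + τ := by push_cast; ring
    have h4 : 1 ≤ Real.exp (K * (k * τ + τ)) := Real.one_le_exp (by positivity)
    rw [h3]
    -- Local error of one step plus propagation of the earlier error.
    calc _ ≤ ‖v (k * τ + τ) - eulerStep h τ (v (k * τ))‖
          + ‖eulerStep h τ (v (k * τ)) - eulerStep h τ ((eulerStep h τ)^[k] (v 0))‖ :=
            norm_sub_le_norm_sub_add_norm_sub _ _ _
      _ ≤ K ^ 2 * r * τ ^ 2 * Real.exp (K * (k * τ + τ)) + Real.exp (K * τ) *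
          (k * (K ^ 2 * r * τ ^ 2) * Real.exp (K * (k * τ))) := by
            refine add_le_add (h1.trans (le_mul_of_one_le_right (by positivity) h4)) (h2.trans ?_)
            gcongr
      _ = _ := by
        rw [show (K : ℝ) * (k * τ + τ) = K * τ + K * (k * τ) by ring, Real.exp_add]
        push_cast
        ring

/-- A map that is analytic at the origin is Lipschitz near the origin. -/
theorem exists_lipschitzOnWith_ball {h : X → X} (hh : AnalyticAt ℂ h 0) :
    ∃ r > 0, ∃ K : ℝ≥0, r ≤ 1 ∧ LipschitzOnWith K h (ball 0 r) := by
  obtain ⟨K, s, hs, hK⟩ := hh.hasStrictFDerivAt.exists_lipschitzOnWith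
  obtain ⟨r, hr, hrs⟩ := Metric.mem_nhds_iff.1 hs
  exact ⟨min r 1, by positivity, K, min_le_right _ _,
    hK.mono ((ball_subset_ball (min_le_left _ _)).trans hrs)⟩

/-- The condition on `δ` involves only the total time `n * τ`, so one ball serves all step sizes. -/
theorem differentiableOn_eulerStep_iterate {h : X → X} {K : ℝ≥0} {r τ δ : ℝ}
    (hL : LipschitzOnWith K h (ball 0 r)) (h0 : h 0 = 0) (hd : DifferentiableOn ℂ h (ball 0 r))
    (hτ : 0 ≤ τ) {n : ℕ} (hδ : Real.exp (K * (n * τ)) * δ ≤ r) :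
    ∀ k ≤ n, DifferentiableOn ℂ ((eulerStep h τ)^[k]) (ball 0 δ) := by
  intro k
  induction k with
  | zero => exact fun _ => differentiableOn_id
  | succ k ih =>
    intro hk
    rw [Function.iterate_succ']
    have hE : DifferentiableOn ℂ (eulerStep h τ) (ball 0 r) :=
      differentiableOn_id.sub (hd.const_smul _)
    refine hE.comp (ih (by omega)) fun x hx => ?_
    rw [mem_ball_zero_iff] at hx ⊢
    have hxr : Real.exp (K * (n * τ)) * ‖x‖ < r := by
      refine lt_of_lt_of_le ?_ hδ
      gcongr
    have hkn : (k : ℝ) ≤ n := by exact_mod_cast (by omega : k ≤ n)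
    exact ((norm_eulerStep_iterate_le hL h0 hτ hxr k (by omega)).trans (by gcongr)).trans_lt hxr

/-- The elements of the semigroup generated by a holomorphic map that vanishes at the origin are
analytic at the origin. -/
theorem IsSemigroupGeneratedBy.analyticAt [CompleteSpace X] {h : X → X} {u : ℝ → X → X}
    (hu : IsSemigroupGeneratedBy u h) (hd : DifferentiableOn ℂ h (ball 0 1)) (h0 : h 0 = 0)
    {t : ℝ} (ht : 0 ≤ t) : AnalyticAt ℂ (u t) 0 := by
  obtain ⟨r, hr, K, hr1, hL⟩ := exists_lipschitzOnWith_ball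
    (analyticAt_of_differentiableOn isOpen_ball hd (mem_ball_self one_pos))
  -- Trajectories starting in this ball stay within `r / 2` up to time `t`.
  set δ := r / (2 * Real.exp ((K + 1) * t)) with hδdef
  have hδ : 0 < δ := by positivity
  have hδr : δ * Real.exp ((K + 1) * t) < r := by
    have : δ * Real.exp ((K + 1) * t) = r / 2 := by rw [hδdef]; field_simp
    linarith
  have hexp : Real.exp (K * t) ≤ Real.exp ((K + 1) * t) := by
    gcongr
    linarith
  have hδK : Real.exp (K * t) * δ ≤ r := by
    refine le_trans ?_ hδr.le
    rw [mul_comm]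
    gcongr
  have hδ1 : ball (0 : X) δ ⊆ ball 0 1 := by
    refine ball_subset_ball (le_trans ?_ (hδr.le.trans hr1))
    exact le_mul_of_one_le_right hδ.le (Real.one_le_exp (by positivity))
  have hτ : ∀ n : ℕ, 0 ≤ t / (n + 1) := fun n => by positivity
  have hnτ : ∀ n : ℕ, ((n + 1 : ℕ) : ℝ) * (t / (n + 1)) = t := fun n => by
    push_cast
    field_simp
  refine analyticAt_of_differentiableOn (U := ball 0 δ) isOpen_ball
    (differentiableOn_ball_of_tendstoUniformlyOn
      (f := fun n : ℕ => (eulerStep h (t / (n + 1)))^[n + 1]) (fun n => ?_) ?_) (mem_ball_self hδ)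
  · exact differentiableOn_eulerStep_iterate hL h0 (hd.mono (ball_subset_ball hr1)) (hτ n)
      (n := n + 1) (by rwa [hnτ]) _ le_rfl
  · rw [Metric.tendstoUniformlyOn_iff]
    intro ε hε
    have hlim : Tendsto (fun n : ℕ => K ^ 2 * r * t ^ 2 * Real.exp (K * t) * (1 / ((n : ℝ) + 1)))
        atTop (𝓝 0) := by
      simpa using tendsto_one_div_add_atTop_nhds_zero_nat.const_mul
        (K ^ 2 * r * t ^ 2 * Real.exp (K * t))
    filter_upwards [hlim.eventually_lt_const hε] with n hn x hx
    have hx1 := hδ1 hx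
    rw [mem_ball_zero_iff] at hx
    have hinit := hu.initial x hx1
    have hbd := norm_trajectory_le hL h0 (v := fun s => u s x) (hu.ode x hx1) hδ
      (by rw [hinit]; exact hx.le) hδr
    have herr := norm_trajectory_sub_eulerStep_iterate_le (n := n + 1) (τ := t / (n + 1)) hL h0
      (v := fun s => u s x) (hu.ode x hx1)
      (fun s hs => by
        rw [hnτ] at hs
        refine ((hbd s hs).trans ?_).trans_lt hδr
        gcongr
        exact hs.2) (hτ n)
      (by
        rw [hnτ, hinit]
        refine lt_of_lt_of_le ?_ hδK
        gcongr) (n + 1) le_rfl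
    rw [hnτ, hinit] at herr
    rw [dist_eq_norm]
    refine (herr.trans (le_of_eq ?_)).trans_lt hn
    push_cast
    field_simp

end Flow

/-! ### Third-order expansion of the flow. -/

section Taylor

open Filter Topology Asymptotics
open scoped NNReal Nat

variable {X : Type*} [NormedAddCommGroup X] [NormedSpace ℂ X]

theorem homPoly_smul (k : ℕ) (h : X → X) (z : ℂ) (x : X) :
    homPoly k h (z • x) = z ^ k • homPoly k h x := by
  have := (iteratedFDeriv ℂ k h 0).map_smul_univ (fun _ => z) (fun _ => x)
  simp only [Finset.prod_const, Finset.card_univ, Fintype.card_fin] at this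
  rw [homPoly, homPoly, this, smul_comm]

theorem norm_homPoly_le (k : ℕ) (h : X → X) (x : X) :
    ‖homPoly k h x‖ ≤ ‖iteratedFDeriv ℂ k h 0‖ * ‖x‖ ^ k := by
  have h1 := (iteratedFDeriv ℂ k h 0).le_opNorm (fun _ => x)
  simp only [Finset.prod_const, Finset.card_univ, Fintype.card_fin] at h1
  rw [homPoly, norm_smul, norm_div, norm_one, Complex.norm_natCast]
  have h2 : (1 : ℝ) / k ! ≤ 1 := by
    rw [div_le_one (by positivity)]
    exact_mod_cast Nat.one_le_iff_ne_zero.2 (Nat.factorial_ne_zero k)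
  exact (mul_le_of_le_one_left (norm_nonneg _) h2).trans h1

theorem homPoly_two_eq (h : X → X) (x : X) :
    homPoly 2 h x = (1 / 2 : ℂ) • fderiv ℂ (fderiv ℂ h) 0 x x := by
  simp [homPoly, iteratedFDeriv_two_apply]

/-- Polarization: symmetry of the second derivative merges the two cross terms. -/
theorem homPoly_two_add [CompleteSpace X] {h : X → X} (hh : AnalyticAt ℂ h 0) (x y : X) :
    homPoly 2 h (x + y) =
      homPoly 2 h x + fderiv ℂ (fderiv ℂ h) 0 x y + homPoly 2 h y := by
  have hsymm : IsSymmSndFDerivAt ℂ h 0 := hh.contDiffAt.isSymmSndFDerivAt_of_omega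
  have := hsymm y x
  simp only [homPoly_two_eq, map_add, add_apply, this]
  module

/-- Taylor expansion of order three. -/
theorem isBigO_sub_homPoly [CompleteSpace X] {f : X → X} (hf : AnalyticAt ℂ f 0) :
    (fun x => f x - (f 0 + fderiv ℂ f 0 x + homPoly 2 f x + homPoly 3 f x))
      =O[𝓝 0] fun x => ‖x‖ ^ 4 := by
  obtain ⟨p, R, hp⟩ := hf
  have h1 := hp.hasFPowerSeriesAt.isBigO_sub_partialSum_pow 4
  refine h1.congr_left fun x => ?_
  have hk : ∀ k, p k (fun _ => x) = homPoly k f x := fun k => by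
    rw [homPoly, ← hp.factorial_smul x k, ← Nat.cast_smul_eq_nsmul ℂ, smul_smul,
      one_div_mul_cancel (by exact_mod_cast Nat.factorial_ne_zero k), one_smul]
  simp only [FormalMultilinearSeries.partialSum, Finset.sum_range_succ, Finset.sum_range_zero, hk,
    zero_add]
  simp [homPoly]

/-- A polynomial in one complex variable of degree less than `n` that is `O(z ^ n)` vanishes. -/
theorem eq_zero_of_isBigO_pow (n : ℕ) : ∀ a : ℕ → X,
    (fun z : ℂ => ∑ i ∈ Finset.range n, z ^ i • a i) =O[𝓝[≠] 0] (fun z => z ^ n) →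
      ∀ i < n, a i = 0 := by
  induction n with
  | zero => simp
  | succ n ih =>
    intro a ha
    have h0 : a 0 = 0 := by
      have h1 : Tendsto (fun z : ℂ => ∑ i ∈ Finset.range (n + 1), z ^ i • a i) (𝓝[≠] 0) (𝓝 0) := by
        refine ha.trans_tendsto ?_
        have : Tendsto (fun z : ℂ => z ^ (n + 1)) (𝓝 0) (𝓝 (0 ^ (n + 1))) :=
          (continuous_pow (n + 1)).tendsto 0
        rw [zero_pow (Nat.succ_ne_zero n)] at this
        exact this.mono_left nhdsWithin_le_nhds
      have h2 : Tendsto (fun z : ℂ => ∑ i ∈ Finset.range (n + 1), z ^ i • a i) (𝓝[≠] 0) (𝓝 (a 0)) := by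
        have hc : Continuous fun z : ℂ => ∑ i ∈ Finset.range (n + 1), z ^ i • a i := by fun_prop
        have := hc.tendsto 0
        rw [Finset.sum_range_succ'] at this
        simp only [ne_eq, Nat.add_eq_zero_iff, one_ne_zero, and_false, not_false_eq_true, zero_pow,
          zero_smul, Finset.sum_const_zero, pow_zero, one_smul, zero_add] at this
        exact this.mono_left nhdsWithin_le_nhds
      exact tendsto_nhds_unique h2 h1
    have hsucc := ih (fun i => a (i + 1)) (by
      obtain ⟨C, hC⟩ := ha.bound
      refine IsBigO.of_bound C ?_
      filter_upwards [hC, self_mem_nhdsWithin] with z hz hz0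
      have hz0' : 0 < ‖z‖ := norm_pos_iff.2 hz0
      rw [Finset.sum_range_succ', h0, smul_zero, add_zero] at hz
      have : ∑ i ∈ Finset.range n, z ^ (i + 1) • a (i + 1) =
          z • ∑ i ∈ Finset.range n, z ^ i • a (i + 1) := by
        rw [Finset.smul_sum]
        exact Finset.sum_congr rfl fun i _ => by rw [smul_smul, pow_succ']
      rw [this, norm_smul, pow_succ', norm_mul] at hz
      refine le_of_mul_le_mul_left (hz.trans (le_of_eq ?_)) hz0'
      ring)
    intro i hi
    cases i with
    | zero => exact h0
    | succ i => exact hsucc i (by omega)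

/-- The Taylor polynomial of degree three of the flow of `-h` at time `s`. -/
noncomputable def cubicFlow (h : X → X) (s : ℝ) (x : X) : X :=
  ((Real.exp (-s) : ℝ) : ℂ) • x
    + ((Real.exp (-s) * (Real.exp (-s) - 1) : ℝ) : ℂ) • homPoly 2 h x
    + ((Real.exp (-s) * (Real.exp (-s) ^ 2 - 1) / 2 : ℝ) : ℂ) • homPoly 3 h x
    + ((Real.exp (-s) * (1 - Real.exp (-s)) ^ 2 / 2 : ℝ) : ℂ) •
        fderiv ℂ (fderiv ℂ h) 0 x (homPoly 2 h x)

/-- The time derivative of `cubicFlow`. -/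
noncomputable def cubicFlowDeriv (h : X → X) (s : ℝ) (x : X) : X :=
  ((-Real.exp (-s) : ℝ) : ℂ) • x
    + ((Real.exp (-s) - 2 * Real.exp (-s) ^ 2 : ℝ) : ℂ) • homPoly 2 h x
    + (((Real.exp (-s) - 3 * Real.exp (-s) ^ 3) / 2 : ℝ) : ℂ) • homPoly 3 h x
    + (((-Real.exp (-s) + 4 * Real.exp (-s) ^ 2 - 3 * Real.exp (-s) ^ 3) / 2 : ℝ) : ℂ) •
        fderiv ℂ (fderiv ℂ h) 0 x (homPoly 2 h x)

theorem cubicFlow_zero_left (h : X → X) (x : X) : cubicFlow h 0 x = x := by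
  simp [cubicFlow]

theorem hasDerivAt_cubicFlow (h : X → X) (s : ℝ) (x : X) :
    HasDerivAt (fun s => cubicFlow h s x) (cubicFlowDeriv h s x) s := by
  have hE : HasDerivAt (fun s : ℝ => Real.exp (-s)) (-Real.exp (-s)) s := by
    simpa using (hasDerivAt_neg s).exp
  have key : ∀ {a : ℝ → ℝ} {a' : ℝ} (y : X), HasDerivAt a a' s →
      HasDerivAt (fun s => ((a s : ℝ) : ℂ) • y) ((a' : ℂ) • y) s := fun y ha =>
    ha.ofReal_comp.smul_const y
  refine (((key x hE).add (key _ ?_)).add (key _ ?_)).add (key _ ?_)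
  · exact (hE.mul (hE.sub_const 1)).congr_deriv (by ring)
  · exact ((hE.mul ((hE.pow 2).sub_const 1)).div_const 2).congr_deriv (by
      simp only [Pi.pow_apply, Nat.cast_ofNat, Nat.add_one_sub_one]; ring)
  · exact ((hE.mul ((hE.const_sub 1).pow 2)).div_const 2).congr_deriv (by
      simp only [Pi.pow_apply, Nat.cast_ofNat, Nat.add_one_sub_one]; ring)

/-- Continuous time coefficients are bounded on `[0, t]`. The filter `𝓝 0 ×ˢ 𝓟 (Icc 0 t)` encodes
uniformity in time. -/
theorem isBigO_ofReal_smul {a : ℝ → ℝ} (ha : Continuous a) {t : ℝ} {f : X × ℝ → X} {k : ℕ}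
    (hf : f =O[𝓝 0 ×ˢ 𝓟 (Icc 0 t)] fun q => ‖q.1‖ ^ k) :
    (fun q => ((a q.2 : ℝ) : ℂ) • f q) =O[𝓝 0 ×ˢ 𝓟 (Icc 0 t)] fun q => ‖q.1‖ ^ k := by
  obtain ⟨C, hC⟩ := isCompact_Icc.exists_bound_of_continuousOn (ha.continuousOn (s := Icc 0 t))
  have h1 : (fun q : X × ℝ => ((a q.2 : ℝ) : ℂ)) =O[𝓝 0 ×ˢ 𝓟 (Icc 0 t)] fun _ => (1 : ℝ) := by
    refine IsBigO.of_bound C ?_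
    rw [eventually_prod_principal_iff]
    refine Eventually.of_forall fun x s hs => ?_
    simpa using hC s hs
  simpa using h1.smul hf

/-- `cubicFlow` solves the flow equation up to an error of order four, uniformly in time. -/
theorem isBigO_cubicFlowDeriv_add [CompleteSpace X] {h : X → X} (hh : AnalyticAt ℂ h 0)
    (h0 : h 0 = 0) (h1 : fderiv ℂ h 0 = ContinuousLinearMap.id ℂ X) (t : ℝ) :
    Tendsto (fun q : X × ℝ => cubicFlow h q.2 q.1) (𝓝 0 ×ˢ 𝓟 (Icc 0 t)) (𝓝 0) ∧
    (fun q : X × ℝ => cubicFlowDeriv h q.2 q.1 + h (cubicFlow h q.2 q.1))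
      =O[𝓝 0 ×ˢ 𝓟 (Icc 0 t)] fun q => ‖q.1‖ ^ 4 := by
  set l : Filter (X × ℝ) := 𝓝 0 ×ˢ 𝓟 (Icc 0 t) with hl
  set b := fderiv ℂ (fderiv ℂ h) 0 with hb
  have hfst : Tendsto (fun q : X × ℝ => q.1) l (𝓝 0) := tendsto_fst
  have hpow : ∀ {m n : ℕ}, m ≤ n → (fun q : X × ℝ => ‖q.1‖ ^ n) =O[l] fun q => ‖q.1‖ ^ m :=
    fun {m n} hmn => by
      refine IsBigO.of_bound 1 ?_
      filter_upwards [hfst.norm.eventually_le_const (by simp : ‖(0 : X)‖ < 1)] with q hq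
      simpa using pow_le_pow_of_le_one (norm_nonneg _) hq hmn
  have hbil : ∀ {f g : X × ℝ → X} {m n : ℕ}, f =O[l] (fun q => ‖q.1‖ ^ m) →
      g =O[l] (fun q => ‖q.1‖ ^ n) → (fun q => b (f q) (g q)) =O[l] fun q => ‖q.1‖ ^ (m + n) := by
    intro f g m n hf hg
    refine IsBigO.trans (IsBigO.of_bound ‖b‖ (g := fun q => ‖f q‖ * ‖g q‖) ?_) ?_
    · exact Eventually.of_forall fun q => by
        simpa [mul_assoc] using b.le_opNorm₂ (f q) (g q)
    · simpa only [pow_add] using hf.norm_left.mul hg.norm_left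
  have hX : (fun q : X × ℝ => q.1) =O[l] fun q => ‖q.1‖ ^ 1 := by
    simpa using (isBigO_refl (fun q : X × ℝ => q.1) l).norm_right
  have hH : ∀ k, (fun q : X × ℝ => homPoly k h q.1) =O[l] fun q => ‖q.1‖ ^ k := fun k =>
    IsBigO.of_bound _ (Eventually.of_forall fun q => by simpa using norm_homPoly_le k h q.1)
  have hbX : (fun q : X × ℝ => b q.1 (homPoly 2 h q.1)) =O[l] fun q => ‖q.1‖ ^ 3 := hbil hX (hH 2)
  have hA : (fun q : X × ℝ => ((Real.exp (-q.2) : ℝ) : ℂ) • q.1) =O[l] fun q => ‖q.1‖ ^ 1 :=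
    isBigO_ofReal_smul (a := fun s => Real.exp (-s)) (by fun_prop) hX
  have hQ : (fun q : X × ℝ => ((Real.exp (-q.2) * (Real.exp (-q.2) - 1) : ℝ) : ℂ) •
      homPoly 2 h q.1) =O[l] fun q => ‖q.1‖ ^ 2 :=
    isBigO_ofReal_smul (a := fun s => Real.exp (-s) * (Real.exp (-s) - 1)) (by fun_prop) (hH 2)
  set e₂ : X × ℝ → X := fun q =>
    ((Real.exp (-q.2) * (Real.exp (-q.2) ^ 2 - 1) / 2 : ℝ) : ℂ) • homPoly 3 h q.1
    + ((Real.exp (-q.2) * (1 - Real.exp (-q.2)) ^ 2 / 2 : ℝ) : ℂ) • b q.1 (homPoly 2 h q.1) with he₂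
  have hE₂ : e₂ =O[l] fun q => ‖q.1‖ ^ 3 :=
    (isBigO_ofReal_smul (a := fun s => Real.exp (-s) * (Real.exp (-s) ^ 2 - 1) / 2)
      (by fun_prop) (hH 3)).add
    (isBigO_ofReal_smul (a := fun s => Real.exp (-s) * (1 - Real.exp (-s)) ^ 2 / 2)
      (by fun_prop) hbX)
  set e₁ : X × ℝ → X := fun q => ((Real.exp (-q.2) * (Real.exp (-q.2) - 1) : ℝ) : ℂ) •
      homPoly 2 h q.1 + e₂ q with he₁
  have hE₁ : e₁ =O[l] fun q => ‖q.1‖ ^ 2 := hQ.add (hE₂.trans (hpow (by norm_num)))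
  have hw : ∀ q : X × ℝ, cubicFlow h q.2 q.1 = ((Real.exp (-q.2) : ℝ) : ℂ) • q.1 + e₁ q :=
    fun q => by simp only [cubicFlow, he₁, he₂, ← hb]; abel
  have hW : (fun q : X × ℝ => cubicFlow h q.2 q.1) =O[l] fun q => ‖q.1‖ ^ 1 := by
    simp only [hw]
    exact hA.add (hE₁.trans (hpow (by norm_num)))
  have hWlim : Tendsto (fun q : X × ℝ => cubicFlow h q.2 q.1) l (𝓝 0) := by
    refine hW.trans_tendsto ?_
    simpa using hfst.norm
  refine ⟨hWlim, ?_⟩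
  have hT := (isBigO_sub_homPoly hh).comp_tendsto hWlim
  simp only [h0, h1, ContinuousLinearMap.id_apply, zero_add, Function.comp_def] at hT
  have hT' : (fun q : X × ℝ => h (cubicFlow h q.2 q.1) - (cubicFlow h q.2 q.1
      + homPoly 2 h (cubicFlow h q.2 q.1) + homPoly 3 h (cubicFlow h q.2 q.1)))
      =O[l] fun q => ‖q.1‖ ^ 4 :=
    hT.trans (by simpa using hW.norm_left.pow 4)
  -- In `H_3` only the linear part of `cubicFlow` matters: the change is at most of order `‖x‖^2
  -- ‖e₁‖`.
  have hcub : (fun q : X × ℝ => homPoly 3 h (cubicFlow h q.2 q.1)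
      - homPoly 3 h (((Real.exp (-q.2) : ℝ) : ℂ) • q.1)) =O[l] fun q => ‖q.1‖ ^ 4 := by
    have hmax : (fun q : X × ℝ => max ‖cubicFlow h q.2 q.1‖ ‖((Real.exp (-q.2) : ℝ) : ℂ) • q.1‖)
        =O[l] fun q => ‖q.1‖ ^ 1 := by
      refine IsBigO.trans (IsBigO.of_bound 1 (Eventually.of_forall fun q => ?_))
        (hW.norm_left.add hA.norm_left)
      rw [Real.norm_of_nonneg (by positivity), Real.norm_of_nonneg (by positivity), one_mul]
      exact max_le_add_of_nonneg (norm_nonneg _) (norm_nonneg _)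
    refine IsBigO.trans (IsBigO.of_bound (‖iteratedFDeriv ℂ 3 h 0‖ * 3)
      (g := fun q => max ‖cubicFlow h q.2 q.1‖ ‖((Real.exp (-q.2) : ℝ) : ℂ) • q.1‖ ^ 2 * ‖e₁ q‖)
      (Eventually.of_forall fun q => ?_)) (((hmax.pow 2).mul hE₁.norm_left).trans ?_)
    · have := (iteratedFDeriv ℂ 3 h 0).norm_image_sub_le (fun _ => cubicFlow h q.2 q.1)
        (fun _ => ((Real.exp (-q.2) : ℝ) : ℂ) • q.1)
      simp only [pi_norm_const, Fintype.card_fin, Nat.add_one_sub_one, Nat.cast_ofNat] at this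
      have hsub : ‖(fun _ : Fin 3 => cubicFlow h q.2 q.1) -
          (fun _ => ((Real.exp (-q.2) : ℝ) : ℂ) • q.1)‖ = ‖e₁ q‖ := by
        rw [← pi_norm_const (ι := Fin 3) (e₁ q)]
        congr 1
        ext i
        simp [hw]
      rw [hsub] at this
      rw [homPoly, homPoly, ← smul_sub, norm_smul]
      have h6 : ‖(1 / (Nat.factorial 3 : ℂ))‖ ≤ 1 := by norm_num [Nat.factorial]
      refine (mul_le_of_le_one_left (norm_nonneg _) h6).trans (this.trans (le_of_eq ?_))
      rw [norm_mul, norm_norm, Real.norm_of_nonneg (by positivity)]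
      ring
    · refine (IsBigO.of_bound 1 (Eventually.of_forall fun q => ?_))
      simp only [pow_one, ← pow_add, one_mul, le_refl]
  -- The parts of `H_2(cubicFlow)` of order four: the cross term with `e₂` and the square of `e₁`.
  have hquad := (isBigO_ofReal_smul (a := fun s => Real.exp (-s)) (t := t) (by fun_prop)
    (hbil hX hE₂)).add ((hbil hE₁ hE₁).const_smul_left (1 / 2 : ℂ))
  refine ((hT'.add hcub).add hquad).congr_left fun q => ?_
  have hexp : homPoly 2 h (cubicFlow h q.2 q.1) = ((Real.exp (-q.2) : ℝ) : ℂ) ^ 2 • homPoly 2 h q.1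
      + ((Real.exp (-q.2) : ℝ) : ℂ) • (((Real.exp (-q.2) * (Real.exp (-q.2) - 1) : ℝ) : ℂ) •
        b q.1 (homPoly 2 h q.1) + b q.1 (e₂ q)) + (1 / 2 : ℂ) • b (e₁ q) (e₁ q) := by
    rw [hw, homPoly_two_add hh, homPoly_smul, ← homPoly_two_eq]
    congr 2
    simp only [he₁, map_smul, map_add, ← hb, smul_apply]
    module
  rw [hexp, homPoly_smul]
  simp only [Pi.smul_apply]
  -- These two terms cancel and must not be unfolded; the rest is the scalar equations for the
  -- coefficients.
  generalize h (cubicFlow h q.2 q.1) = y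
  generalize homPoly 3 h (cubicFlow h q.2 q.1) = y'
  simp only [cubicFlow, cubicFlowDeriv, ← hb]
  push_cast
  module

/-- The flow agrees with `cubicFlow` up to an error of order four. -/
theorem IsSemigroupGeneratedBy.isBigO_sub_cubicFlow [CompleteSpace X] {h : X → X}
    {u : ℝ → X → X} (hu : IsSemigroupGeneratedBy u h) (hh : AnalyticAt ℂ h 0)
    (h0 : h 0 = 0) (h1 : fderiv ℂ h 0 = ContinuousLinearMap.id ℂ X) {t : ℝ} (ht : 0 ≤ t) :
    (fun x => u t x - cubicFlow h t x) =O[𝓝 0] fun x => ‖x‖ ^ 4 := by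
  obtain ⟨r, hr, K, hr1, hL⟩ := exists_lipschitzOnWith_ball hh
  obtain ⟨hlim, hO⟩ := isBigO_cubicFlowDeriv_add hh h0 h1 t
  obtain ⟨C, hC0, hC⟩ := hO.exists_pos
  have hC' := eventually_prod_principal_iff.1 hC.bound
  have hwr := eventually_prod_principal_iff.1 (hlim.eventually (ball_mem_nhds 0 hr))
  set δ := r / (2 * Real.exp ((K + 1) * t)) with hδdef
  have hδ : 0 < δ := by positivity
  have hδr : δ * Real.exp ((K + 1) * t) < r := by
    have : δ * Real.exp ((K + 1) * t) = r / 2 := by rw [hδdef]; field_simp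
    linarith
  -- Enlarging `K` to `K + 1` makes the Gronwall constant nonzero.
  have hL' : LipschitzOnWith (K + 1) (fun x => -h x) (ball 0 r) := by
    refine LipschitzOnWith.of_dist_le_mul fun x hx y hy => ?_
    rw [dist_neg_neg]
    refine (hL.dist_le_mul x hx y hy).trans ?_
    push_cast
    gcongr
    linarith
  refine IsBigO.of_bound (C / ((K : ℝ) + 1) * (Real.exp ((K + 1) * t) - 1)) ?_
  filter_upwards [hC', hwr, ball_mem_nhds 0 hδ, ball_mem_nhds 0 one_pos] with x hxC hxr hxδ hx1
  rw [mem_ball_zero_iff] at hxδ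
  have hinit := hu.initial x hx1
  have hbd := norm_trajectory_le hL h0 (v := fun s => u s x) (hu.ode x hx1) hδ
    (by rw [hinit]; exact hxδ.le) hδr
  -- The flow has defect `0`, `cubicFlow` has defect `C * ‖x‖ ^ 4`, and they start at the same
  -- point.
  have key := dist_le_of_approx_trajectories_ODE_of_mem (v := fun _ x => -h x) (K := K + 1)
    (s := fun _ => ball 0 r) (f := fun s => u s x) (f' := fun s => -h (u s x))
    (g := fun s => cubicFlow h s x) (g' := fun s => cubicFlowDeriv h s x) (a := 0) (b := t)
    (εf := 0) (εg := C * ‖x‖ ^ 4) (δ := 0) (fun _ _ => hL')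
    (fun s hs => (hu.ode x hx1 s hs.1).continuousWithinAt.mono fun y hy => hy.1)
    (fun s hs => (hu.ode x hx1 s hs.1).mono fun y hy => hs.1.trans hy)
    (fun s _ => by simp)
    (fun s hs => by
      rw [mem_ball_zero_iff]
      refine ((hbd s ⟨hs.1, hs.2.le⟩).trans ?_).trans_lt hδr
      gcongr
      exact hs.2.le)
    (fun s _ => (hasDerivAt_cubicFlow h s x).continuousAt.continuousWithinAt)
    (fun s _ => (hasDerivAt_cubicFlow h s x).hasDerivWithinAt)
    (fun s hs => by
      rw [dist_eq_norm, sub_neg_eq_add]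
      simpa using hxC s ⟨hs.1, hs.2.le⟩)
    (fun s hs => hxr s ⟨hs.1, hs.2.le⟩)
    (by rw [hinit, cubicFlow_zero_left, dist_self]) t ⟨ht, le_rfl⟩
  rw [gronwallBound_of_K_ne_0 (by positivity), dist_eq_norm] at key
  refine key.trans (le_of_eq ?_)
  simp only [norm_pow, norm_norm, NNReal.coe_add, NNReal.coe_one, sub_zero]
  ring

end Taylor

/-! ### Comparison of Taylor coefficients. -/

section Coefficients

open Filter Topology Asymptotics

variable {X : Type*} [NormedAddCommGroup X] [NormedSpace ℂ X]

/-- The Taylor coefficients of degree two and three of the semigroup elements. -/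
theorem IsSemigroupGeneratedBy.homPoly_eq [CompleteSpace X] {h : X → X}
    {u : ℝ → X → X} (hu : IsSemigroupGeneratedBy u h) (hd : DifferentiableOn ℂ h (ball 0 1))
    (h0 : h 0 = 0) (h1 : fderiv ℂ h 0 = ContinuousLinearMap.id ℂ X) {t : ℝ} (ht : 0 ≤ t) (e : X) :
    homPoly 2 (u t) e = ((Real.exp (-t) * (Real.exp (-t) - 1) : ℝ) : ℂ) • homPoly 2 h e ∧
    homPoly 3 (u t) e =
      ((Real.exp (-t) * (Real.exp (-t) ^ 2 - 1) / 2 : ℝ) : ℂ) • homPoly 3 h e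
      + ((Real.exp (-t) * (1 - Real.exp (-t)) ^ 2 / 2 : ℝ) : ℂ) •
        fderiv ℂ (fderiv ℂ h) 0 e (homPoly 2 h e) := by
  have hh := analyticAt_of_differentiableOn isOpen_ball hd (mem_ball_self one_pos)
  have hO := (hu.isBigO_sub_cubicFlow hh h0 h1 ht).sub (isBigO_sub_homPoly (hu.analyticAt hd h0 ht))
  have hlim : Tendsto (fun z : ℂ => z • e) (𝓝[≠] 0) (𝓝 0) := by
    have : Tendsto (fun z : ℂ => z • e) (𝓝 0) (𝓝 ((0 : ℂ) • e)) :=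
      (by fun_prop : Continuous fun z : ℂ => z • e).tendsto 0
    rw [zero_smul] at this
    exact this.mono_left nhdsWithin_le_nhds
  have hz := hO.comp_tendsto hlim
  -- Coefficients of `z ^ k` in the difference of the two expansions along `z • e`.
  let c : ℕ → X := fun k => match k with
    | 0 => u t 0
    | 1 => fderiv ℂ (u t) 0 e - ((Real.exp (-t) : ℝ) : ℂ) • e
    | 2 => homPoly 2 (u t) e - ((Real.exp (-t) * (Real.exp (-t) - 1) : ℝ) : ℂ) • homPoly 2 h e
    | _ => homPoly 3 (u t) e -
      (((Real.exp (-t) * (Real.exp (-t) ^ 2 - 1) / 2 : ℝ) : ℂ) • homPoly 3 h e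
      + ((Real.exp (-t) * (1 - Real.exp (-t)) ^ 2 / 2 : ℝ) : ℂ) •
        fderiv ℂ (fderiv ℂ h) 0 e (homPoly 2 h e))
  have hc := eq_zero_of_isBigO_pow 4 c (by
    refine IsBigO.trans (hz.congr_left fun z => ?_) (IsBigO.of_bound (‖e‖ ^ 4)
      (Eventually.of_forall fun z => ?_))
    · simp only [Function.comp_apply, cubicFlow, homPoly_smul, map_smul, smul_apply,
        Finset.sum_range_succ, Finset.sum_range_zero, c]
      module
    · simp only [Function.comp_apply, norm_smul, norm_pow, norm_mul, norm_norm]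
      rw [mul_pow, mul_comm])
  exact ⟨sub_eq_zero.1 (hc 2 (by norm_num)), sub_eq_zero.1 (hc 3 (by norm_num))⟩

end Coefficients

end FeketeSzego

/-! ### The coefficients in terms of `Ψ`. -/

theorem mainTheorem3 {X : Type*} [NormedAddCommGroup X] [NormedSpace ℂ X] [CompleteSpace X]
    (h : X → X) (hM : FeketeSzego.ClassM h)
    (u : ℝ → X → X) (hu : FeketeSzego.IsSemigroupGeneratedBy u h)
    (t : ℝ) (ht : 0 ≤ t) :
    AnalyticAt ℂ (u t) 0 ∧
    ∀ e : X, ‖e‖ = 1 →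
      (1 / 2 : ℂ) • iteratedFDeriv ℂ 2 (u t) 0 (fun _ => e) =
        ((Real.exp (-t) * (Real.exp (-t) - 1) : ℝ) : ℂ) • FeketeSzego.homPoly 2 h e ∧
      ∀ eStar ∈ FeketeSzego.supportFunctionals e,
        (1 / 6 : ℂ) • iteratedFDeriv ℂ 3 (u t) 0 (fun _ => e) =
          ((Real.exp (-t) * (Real.exp (-2 * t) - 1) / 2 : ℝ) : ℂ) •
            FeketeSzego.Psi e eStar h
              ((2 * (1 - Real.exp (-t)) / (1 + Real.exp (-t)) : ℝ) : ℂ)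
              ((2 * (1 - Real.exp (-t)) / (1 + Real.exp (-t)) : ℝ) : ℂ) := by
  have hexp : 1 + Real.exp (-t) ≠ 0 := by positivity
  have hexp2 : Real.exp (-2 * t) = Real.exp (-t) ^ 2 := by
    rw [← Real.exp_nat_mul]; push_cast; ring_nf
  refine ⟨hu.analyticAt hM.holomorphic hM.map_zero ht, fun e _ => ?_⟩
  obtain ⟨h2, h3⟩ := hu.homPoly_eq hM.holomorphic hM.map_zero hM.fderiv_zero ht e
  refine ⟨?_, fun eStar _ => ?_⟩
  · rw [← h2]
    simp [FeketeSzego.homPoly]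
  · have hl : (1 / 6 : ℂ) • iteratedFDeriv ℂ 3 (u t) 0 (fun _ => e) =
        FeketeSzego.homPoly 3 (u t) e := by
      norm_num [FeketeSzego.homPoly, Nat.factorial]
    rw [hl, h3, FeketeSzego.Psi, iteratedFDeriv_two_apply, hexp2, sub_self, zero_mul, zero_smul,
      sub_zero, smul_sub, smul_smul]
    -- With `a = exp (-t)`, this is `(a^2 - 1)(1 - a)/(1 + a) = -(1 - a)^2`.
    have hcoef : ((Real.exp (-t) * (Real.exp (-t) ^ 2 - 1) / 2 : ℝ) : ℂ) *
        (((2 * (1 - Real.exp (-t)) / (1 + Real.exp (-t)) : ℝ) : ℂ) / 2) =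
        -((Real.exp (-t) * (1 - Real.exp (-t)) ^ 2 / 2 : ℝ) : ℂ) := by
      rw [← Complex.ofReal_ofNat, ← Complex.ofReal_div, ← Complex.ofReal_mul, ← Complex.ofReal_neg]
      congr 1
      field_simp
      ring
    rw [hcoef, neg_smul, sub_neg_eq_add]
    rfl
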